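/- **Setting.** A stable matching instance $A$ (with complete lists) consists of $n$ boys and $n$ girls; each agent ranks all agents of the opposite sex in a strict preference list. A matching is a perfect matching $M$ of boys with girls. A pair $xy$ blocks $M$ if $x$ and $y$ strictly prefer each other to their $M$-partners, and $M$ is stable if no pair blocks it. Let $\mathcal M_A$ be the set of stable matchings of $A$. For $M\in\mathcal M_A$ and a boy $x$ let $s_M(x)$ be the first girl on $x$'s list who strictly prefers $x$ to her $M$-partner (if there is one). A *rotation exposed in $M$* is a nonempty cyclic sequence $\rho=(x_0y_0,\dots,x_{r-1}y_{r-1})$ of distinct (boy, girl) pairs of $M$ with $s_M(x_i)=y_{i+1}$ for all $i$ (indices modulo $r$; cyclic shifts of the sequence are the same rotation). $M/\rho$ is the matching in which each $x_i$ is matched to $y_{i+1}$ and all other boys keep their partners; $M/\rho$ is again stable. A *rotation of $A$* is a rotation exposed in some $M\in\mathcal M_A$. The rotation $\rho$ *moves* $x_i$ from $y_i$ to $y_{i+1}$ and moves $y_i$ from $x_i$ to $x_{i-1}$. It *moves $x_i$ below* a girl $y$ if $y=y_i$ or $y$ is strictly between $y_i$ and $y_{i+1}$ on $x_i$'s list,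 and it *moves $y_i$ above* a boy $x$ if $x=x_i$ or $x$ is strictly between $x_i$ and $x_{i-1}$ on $y_i$'s list. For $\mathcal S\subseteq\mathcal M_A$, let $I_{\mathcal S}$ be the set of rotations $\rho$ that are exposed in some $M\in\mathcal M_A$ with $M\notin\mathcal S$ and $M/\rho\in\mathcal S$ (the rotations going into $\mathcal S$), and $O_{\mathcal S}$ the set of rotations $\rho$ that are exposed in some $M\in\mathcal M_A$ with $M\in\mathcal S$ and $M/\rho\notin\mathcal S$ (the rotations going out of $\mathcal S$). **Theorem.** Let $b$ be a boy and $g$ a girl. (1) *Shift in a girl's list.* Let $B$ be obtained from $A$ by changing $g$'s list from $(\dots,b_1,\dots,b_k,b,\dots)$ to $(\dots,b,b_1,\dots,b_k,\dots)$, where $k\ge 0$, and leaving all else unchanged, and let $\mathcal M_{AB}=\mathcal M_A\setminus\mathcal M_B$. Then $I_{\mathcal M_{AB}}$ and $O_{\mathcal M_{AB}}$ each contain at most one rotation. If either of them is nonempty, then so is $\mathcal M_{AB}$; in that case let $b^+$ and $b^-$ be $g$'s most and least preferred (by her list in $A$) among the boys who are her partners in some matching of $\mathcal M_{AB}$. A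 rotation in $I_{\mathcal M_{AB}}$ is either $\rho_1$, the unique rotation of $A$ that moves $g$ to $b^-$, or $\rho_2$, the unique rotation of $A$ that moves $b$ below $g$. A rotation in $O_{\mathcal M_{AB}}$ is $\rho_3$, the unique rotation of $A$ that moves $g$ from $b^+$. (2) *Shift in a boy's list.* Let $B$ be obtained from $A$ by changing $b$'s list from $(\dots,g_1,\dots,g_k,g,\dots)$ to $(\dots,g,g_1,\dots,g_k,\dots)$, where $k\ge 0$, and leaving all else unchanged, and let $\mathcal M_{AB}=\mathcal M_A\setminus\mathcal M_B$. Then $I_{\mathcal M_{AB}}$ and $O_{\mathcal M_{AB}}$ each contain at most one rotation. If either of them is nonempty, then so is $\mathcal M_{AB}$; in that case let $g^+$ and $g^-$ be $b$'s most and least preferred (by his list in $A$) among the girls who are his partners in some matching of $\mathcal M_{AB}$. A rotation in $I_{\mathcal M_{AB}}$ is the unique rotation of $A$ that moves $b$ to $g^+$. A rotation in $O_{\mathcal M_{AB}}$ is either the unique rotation of $A$ that moves $b$ from $g^-$, or the unique rotation of $A$ that moves $g$ above $b$. -/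

import Mathlib

/-- A stable matching instance with complete preference lists. Each agent's list contains every agent
of the opposite sex exactly once, and earlier entries are preferred. -/
structure SMInstance (Boy Girl : Type*) where
  boyList : Boy → List Girl
  girlList : Girl → List Boy
  boyList_nodup : ∀ b, (boyList b).Nodup
  mem_boyList : ∀ b g, g ∈ boyList b
  girlList_nodup : ∀ g, (girlList g).Nodup
  mem_girlList : ∀ g b, b ∈ girlList g

/-- `MatchStep ρ p q`: the pair `q` comes immediately after the pair `p` in the cyclic sequence `ρ`
(subscripts taken modulo the length of `ρ`). -/
def MatchStep {Boy Girl : Type*} (ρ : Cycle (Boy × Girl)) (p q : Boy × Girl) : Prop :=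
  ∃ l : List (Boy × Girl), ρ = (l : Cycle (Boy × Girl)) ∧
    ∃ i : ℕ, l[i]? = some p ∧ l[(i + 1) % l.length]? = some q

/-- `ρ` moves boy `b` from girl `g` to girl `g'`: for some `i`, `b = bᵢ`, `g = gᵢ`, `g' = gᵢ₊₁`. -/
def MovesBoy {Boy Girl : Type*} (ρ : Cycle (Boy × Girl)) (b : Boy) (g g' : Girl) : Prop :=
  ∃ b' : Boy, MatchStep ρ (b, g) (b', g')

/-- `ρ` moves girl `g` from boy `b` to boy `b'`: for some `i`, `g = gᵢ`, `b = bᵢ`, `b' = bᵢ₋₁`. -/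
def MovesGirl {Boy Girl : Type*} (ρ : Cycle (Boy × Girl)) (g : Girl) (b b' : Boy) : Prop :=
  ∃ g' : Girl, MatchStep ρ (b', g') (b, g)

/-- `M'` is the matching `M / ρ`: each boy `bᵢ` of `ρ` is matched to `gᵢ₊₁`, and every other boy keeps
his partner in `M`. A (perfect) matching is a bijection from boys to girls. -/
def IsElimination {Boy Girl : Type*} (M : Boy ≃ Girl) (ρ : Cycle (Boy × Girl))
    (M' : Boy ≃ Girl) : Prop :=
  (∀ b g g', MovesBoy ρ b g g' → M' b = g') ∧
    ∀ b, (∀ p ∈ ρ, p.1 ≠ b) → M' b = M b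

namespace SMInstance

variable {Boy Girl : Type*} [DecidableEq Boy] [DecidableEq Girl]

/-- Boy `b` strictly prefers girl `g` to girl `g'`. -/
def BoyPrefers (A : SMInstance Boy Girl) (b : Boy) (g g' : Girl) : Prop :=
  (A.boyList b).idxOf g < (A.boyList b).idxOf g'

/-- Girl `g` strictly prefers boy `b` to boy `b'`. -/
def GirlPrefers (A : SMInstance Boy Girl) (g : Girl) (b b' : Boy) : Prop :=
  (A.girlList g).idxOf b < (A.girlList g).idxOf b'

/-- `b` and `g` prefer each other to their partners in `M`. -/
def Blocking (A : SMInstance Boy Girl) (M : Boy ≃ Girl) (b : Boy) (g : Girl) : Prop :=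
  A.BoyPrefers b g (M b) ∧ A.GirlPrefers g b (M.symm g)

/-- The set of stable matchings of the instance. -/
def stableMatchings (A : SMInstance Boy Girl) : Set (Boy ≃ Girl) :=
  {M | ∀ b g, ¬ A.Blocking M b g}

/-- `g = s_M(b)`: `g` is the first girl on `b`'s list who strictly prefers `b` to her `M`-partner.
There may be no such girl. -/
def IsFirstWilling (A : SMInstance Boy Girl) (M : Boy ≃ Girl) (b : Boy) (g : Girl) : Prop :=
  A.GirlPrefers g b (M.symm g) ∧
    ∀ g', A.GirlPrefers g' b (M.symm g') → g' = g ∨ A.BoyPrefers b g g'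

/-- The nonempty cyclic sequence `ρ` of distinct pairs `bᵢgᵢ` is a rotation exposed in `M`: every
`bᵢgᵢ` is a pair of `M`, and `gᵢ₊₁ = s_M(bᵢ)`, that is, `bᵢ₊₁` is the `M`-partner of `s_M(bᵢ)`. -/
def Exposed (A : SMInstance Boy Girl) (M : Boy ≃ Girl) (ρ : Cycle (Boy × Girl)) : Prop :=
  ρ ≠ Cycle.nil ∧ ρ.Nodup ∧ (∀ p ∈ ρ, M p.1 = p.2) ∧
    ∀ b g g', MovesBoy ρ b g g' → A.IsFirstWilling M b g'

/-- `ρ` is a rotation of the instance: it is exposed in some stable matching. -/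
def IsRotation (A : SMInstance Boy Girl) (ρ : Cycle (Boy × Girl)) : Prop :=
  ∃ M ∈ A.stableMatchings, A.Exposed M ρ

/-- `ρ` is the rotation of the instance with the property `P`. -/
def IsTheRotation (A : SMInstance Boy Girl) (P : Cycle (Boy × Girl) → Prop)
    (ρ : Cycle (Boy × Girl)) : Prop :=
  A.IsRotation ρ ∧ P ρ ∧ ∀ ρ', A.IsRotation ρ' → P ρ' → ρ' = ρ

/-- `ρ` moves boy `b` below girl `g`. -/
def MovesBoyBelow (A : SMInstance Boy Girl) (b : Boy) (g : Girl)
    (ρ : Cycle (Boy × Girl)) : Prop :=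
  ∃ g₁ g₂, MovesBoy ρ b g₁ g₂ ∧
    (g = g₁ ∨ (A.BoyPrefers b g₁ g ∧ A.BoyPrefers b g g₂))

/-- `ρ` moves girl `g` above boy `b`. -/
def MovesGirlAbove (A : SMInstance Boy Girl) (g : Girl) (b : Boy)
    (ρ : Cycle (Boy × Girl)) : Prop :=
  ∃ b₁ b₂, MovesGirl ρ g b₁ b₂ ∧
    (b = b₁ ∨ (A.GirlPrefers g b₂ b ∧ A.GirlPrefers g b b₁))

/-- The rotations going into the set `S` of stable matchings. -/
def rotationsInto (A : SMInstance Boy Girl) (S : Set (Boy ≃ Girl)) :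
    Set (Cycle (Boy × Girl)) :=
  {ρ | ∃ M M', M ∈ A.stableMatchings ∧ A.Exposed M ρ ∧ IsElimination M ρ M' ∧ M ∉ S ∧ M' ∈ S}

/-- The rotations going out of the set `S` of stable matchings. -/
def rotationsOutOf (A : SMInstance Boy Girl) (S : Set (Boy ≃ Girl)) :
    Set (Cycle (Boy × Girl)) :=
  {ρ | ∃ M M', M ∈ A.stableMatchings ∧ A.Exposed M ρ ∧ IsElimination M ρ M' ∧ M ∈ S ∧ M' ∉ S}

/-- `𝓜_AB`: the matchings that are stable in `A` and not stable in `B`. -/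
def lostMatchings (A B : SMInstance Boy Girl) : Set (Boy ≃ Girl) :=
  A.stableMatchings \ B.stableMatchings

/-- `B` is obtained from `A` by an upward shift of `b` in the list of girl `g`: the list
`…, b₁, …, bₖ, b, …` becomes `…, b, b₁, …, bₖ, …`, and all other lists are unchanged. -/
def IsGirlShift (A B : SMInstance Boy Girl) (g : Girl) (b : Boy) : Prop :=
  (∀ b', B.boyList b' = A.boyList b') ∧ (∀ g', g' ≠ g → B.girlList g' = A.girlList g') ∧
    ∃ pre mid post : List Boy, A.girlList g = pre ++ mid ++ [b] ++ post ∧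
      B.girlList g = pre ++ [b] ++ mid ++ post

/-- `B` is obtained from `A` by an upward shift of `g` in the list of boy `b`. -/
def IsBoyShift (A B : SMInstance Boy Girl) (b : Boy) (g : Girl) : Prop :=
  (∀ g', B.girlList g' = A.girlList g') ∧ (∀ b', b' ≠ b → B.boyList b' = A.boyList b') ∧
    ∃ pre mid post : List Girl, A.boyList b = pre ++ mid ++ [g] ++ post ∧
      B.boyList b = pre ++ [g] ++ mid ++ post

/-- `b` is the best partner that `g` has in any matching of `S`, by her list in the instance. -/
def IsBestBoy (A : SMInstance Boy Girl) (S : Set (Boy ≃ Girl)) (g : Girl) (b : Boy) : Prop :=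
  (∃ M ∈ S, M b = g) ∧ ∀ M ∈ S, M b = g ∨ A.GirlPrefers g b (M.symm g)

/-- `b` is the worst partner that `g` has in any matching of `S`. -/
def IsWorstBoy (A : SMInstance Boy Girl) (S : Set (Boy ≃ Girl)) (g : Girl) (b : Boy) : Prop :=
  (∃ M ∈ S, M b = g) ∧ ∀ M ∈ S, M b = g ∨ A.GirlPrefers g (M.symm g) b

/-- `g` is the best partner that `b` has in any matching of `S`. -/
def IsBestGirl (A : SMInstance Boy Girl) (S : Set (Boy ≃ Girl)) (b : Boy) (g : Girl) : Prop :=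
  (∃ M ∈ S, M b = g) ∧ ∀ M ∈ S, M b = g ∨ A.BoyPrefers b g (M b)

/-- `g` is the worst partner that `b` has in any matching of `S`. -/
def IsWorstGirl (A : SMInstance Boy Girl) (S : Set (Boy ≃ Girl)) (b : Boy) (g : Girl) : Prop :=
  (∃ M ∈ S, M b = g) ∧ ∀ M ∈ S, M b = g ∨ A.BoyPrefers b (M b) g

end SMInstance

/-! Eliminating a rotation improves girls and worsens boys. A stable matching of `A` is lost exactly
when `b` and `g` block it in `B`. For either shift this amounts to three inequalities: the shifted
list's owner has a partner inside the block being passed, and the shifted agent prefers that owner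
to its own partner. Along an elimination each inequality can change in one direction only, so a
rotation entering or leaving the lost set must cross a known threshold. For the girl shift, entry
takes `b` below `g` and exit takes `g` out of the top of the block. For the boy shift, entry takes
`b` into the block from above, and exit either marries `b` to `g` or takes `g` above `b`.

Uniqueness holds because distinct rotations move an agent over non-overlapping intervals of its list
(`eq_of_movesBoy`, `eq_of_movesGirl`). This follows from two facts: no stable partner lies strictly
inside such an interval (`Exposed.not_between_boy`, `Exposed.not_between_girl`), and rotations
sharing a pair coincide (`eq_of_mem_of_mem`). Both compare two stable matchings through their
girl-optimal join (`exists_join`): once the join breaks one pair of an exposed rotation, the break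
travels round the cycle and the join lies beyond the whole rotation (`Exposed.step`,
`Exposed.beyond`). -/

/-! ### Cyclic sequences -/

section Cycles

variable {Boy Girl : Type*} {ρ σ : Cycle (Boy × Girl)} {p q : Boy × Girl}

lemma MatchStep.left_mem (h : MatchStep ρ p q) : p ∈ ρ := by
  obtain ⟨l, rfl, i, hp, -⟩ := h
  exact Cycle.mem_coe_iff.2 (List.mem_of_getElem? hp)

lemma MatchStep.right_mem (h : MatchStep ρ p q) : q ∈ ρ := by
  obtain ⟨l, rfl, i, -, hq⟩ := h
  exact Cycle.mem_coe_iff.2 (List.mem_of_getElem? hq)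

/-- A cyclic sequence can be written as a list that starts with a given member. -/
lemma Cycle.exists_coe_eq_cons {α : Type*} {c : Cycle α} {a : α} (h : a ∈ c) :
    ∃ t : List α, c = ((a :: t : List α) : Cycle α) := by
  induction c using Quotient.inductionOn' with
  | h l =>
    obtain ⟨s, t, rfl⟩ := List.append_of_mem (Cycle.mem_coe_iff.1 h)
    refine ⟨t ++ s, Cycle.coe_eq_coe.2 ?_⟩
    exact ⟨s.length, by simp⟩

lemma matchStep_coe {l : List (Boy × Girl)} {i j : ℕ} (hi : i < l.length) (hj : j < l.length)
    (h : j = (i + 1) % l.length) : MatchStep (l : Cycle (Boy × Girl)) l[i] l[j] := by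
  subst h
  exact ⟨l, rfl, i, List.getElem?_eq_getElem hi, List.getElem?_eq_getElem hj⟩

lemma exists_matchStep_right (h : p ∈ ρ) : ∃ q, MatchStep ρ p q := by
  obtain ⟨t, rfl⟩ := Cycle.exists_coe_eq_cons h
  exact ⟨_, matchStep_coe (l := p :: t) (i := 0) (by simp) (Nat.mod_lt _ (by simp)) rfl⟩

/-- A property that is passed on from each member of a cyclic sequence to the next one holds
everywhere if it holds somewhere. -/
lemma forall_mem_of_matchStep {P : Boy × Girl → Prop} (hp : p ∈ ρ) (h0 : P p)
    (hstep : ∀ q r, MatchStep ρ q r → P q → P r) : ∀ q ∈ ρ, P q := by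
  obtain ⟨t, rfl⟩ := Cycle.exists_coe_eq_cons hp
  have key : ∀ i (hi : i < (p :: t).length), P (p :: t)[i] := by
    intro i
    induction i with
    | zero => intro _; exact h0
    | succ i ih =>
      intro hi
      exact hstep _ _ (matchStep_coe (by lia) hi (Nat.mod_eq_of_lt hi).symm) (ih (by lia))
  intro q hq
  obtain ⟨i, hi, rfl⟩ := List.getElem_of_mem (Cycle.mem_coe_iff.1 hq)
  exact key i hi

/-- Two cyclic sequences without repetitions whose steps obey the same functional relation are
equal as soon as they share a member. -/
lemma eq_of_matchStep_functional {R : Boy × Girl → Boy × Girl → Prop}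
    (hR : ∀ p q r, R p q → R p r → q = r) (hρ : ρ.Nodup) (hσ : σ.Nodup)
    (hρR : ∀ p q, MatchStep ρ p q → R p q) (hσR : ∀ p q, MatchStep σ p q → R p q)
    (hpρ : p ∈ ρ) (hpσ : p ∈ σ) : ρ = σ := by
  obtain ⟨s, rfl⟩ := Cycle.exists_coe_eq_cons hpρ
  obtain ⟨t, rfl⟩ := Cycle.exists_coe_eq_cons hpσ
  rw [Cycle.nodup_coe_iff] at hρ hσ
  have key : ∀ i (hi : i < (p :: s).length) (hj : i < (p :: t).length),
      (p :: s)[i] = (p :: t)[i] := by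
    intro i
    induction i with
    | zero => intros; rfl
    | succ i ih =>
      intro hi hj
      have h1 := hρR _ _ (matchStep_coe (l := p :: s) (by lia) hi (Nat.mod_eq_of_lt hi).symm)
      have h2 := hσR _ _ (matchStep_coe (l := p :: t) (by lia) hj (Nat.mod_eq_of_lt hj).symm)
      rw [ih (by lia) (by lia)] at h1
      exact hR _ _ _ h1 h2
  -- If `u` were shorter, its last entry would be followed by `p`, while the same entry in the
  -- longer list has a later successor; functionality would make `p` occur twice there.
  have wrap : ∀ u v : List (Boy × Girl), (p :: v).Nodup →
      (∀ q r, MatchStep ((p :: u : List _) : Cycle _) q r → R q r) →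
      (∀ q r, MatchStep ((p :: v : List _) : Cycle _) q r → R q r) →
      (∀ i (hi : i < (p :: u).length) (hj : i < (p :: v).length), (p :: u)[i] = (p :: v)[i]) →
      ¬ u.length < v.length := by
    intro u v hv hu' hv' huv hlt
    have h1 := hu' _ _ (matchStep_coe (l := p :: u) (i := u.length) (j := 0) (by simp) (by simp)
      (by simp))
    have hj : u.length + 1 < (p :: v).length := by simpa using hlt
    have h2 := hv' _ _ (matchStep_coe (l := p :: v) (by lia) hj (Nat.mod_eq_of_lt hj).symm)
    rw [huv u.length (by simp) (by lia)] at h1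
    have h3 : (p :: v)[u.length + 1] = (p :: v)[0] := hR _ _ _ h2 h1
    have := (hv.getElem_inj_iff).1 h3
    lia
  have hlen : s.length = t.length := by
    have h1 := wrap s t hσ hρR hσR key
    have h2 := wrap t s hρ hσR hρR fun i hi hj => (key i hj hi).symm
    lia
  rw [List.ext_getElem (l₁ := p :: s) (l₂ := p :: t) (by simp [hlen]) key]

end Cycles

/-! ### Shifting an entry of a preference list -/

/-- Moving an entry `a` of a list upwards, past a block: the order of two entries `x`, `y` changes
only if `x = a` and `y` lies in the block. -/
lemma List.exists_shift_idxOf {α : Type*} [DecidableEq α] {l l' pre mid post : List α} {a : α}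
    (hn : l.Nodup) (hl : l = pre ++ mid ++ [a] ++ post)
    (hl' : l' = pre ++ [a] ++ mid ++ post) :
    ∃ m, (∀ y, m ≤ l.idxOf y → l.idxOf y < l.idxOf a → l'.idxOf a < l'.idxOf y) ∧
      ∀ x y, l'.idxOf x < l'.idxOf y →
        l.idxOf x < l.idxOf y ∨ (x = a ∧ m ≤ l.idxOf y ∧ l.idxOf y < l.idxOf a) := by
  subst hl hl'
  have hd : a ∉ pre ∧ a ∉ mid ∧ a ∉ post ∧ (∀ x ∈ pre, x ∉ mid) := by
    simp only [List.nodup_append, List.mem_append, List.mem_singleton] at hn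
    grind
  obtain ⟨hap, ham, -, hpm⟩ := hd
  -- Old and new positions, by location: before the block, inside it (pushed down by one), `a`
  -- itself, after `a`.
  have pos : ∀ x, ∃ i j, (pre ++ mid ++ [a] ++ post).idxOf x = i ∧
      (pre ++ [a] ++ mid ++ post).idxOf x = j ∧
      (i = j ∧ i < pre.length ∨ (pre.length ≤ i ∧ i < pre.length + mid.length ∧ j = i + 1) ∨
        (x = a ∧ i = pre.length + mid.length ∧ j = pre.length) ∨
        (i = j ∧ pre.length + mid.length < i)) := by
    intro x
    refine ⟨_, _, rfl, rfl, ?_⟩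
    by_cases h1 : x ∈ pre
    · left
      have := List.idxOf_lt_length_of_mem h1
      simp [List.idxOf_append, h1, this]
    by_cases h2 : x = a
    · subst h2
      simp [List.idxOf_append, h1, ham, Nat.add_comm]
    by_cases h3 : x ∈ mid
    · right; left
      have := List.idxOf_lt_length_of_mem h3
      simp only [List.idxOf_append, List.mem_append, List.mem_singleton, h1, h2, h3, or_true,
        or_false, if_true, if_false, List.length_append, List.length_singleton]
      lia
    · right; right; right
      simp only [List.idxOf_append, List.mem_append, List.mem_singleton, h1, h2, h3,
        or_false, if_false, List.length_append, List.length_singleton]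
      lia
  have ha : (pre ++ mid ++ [a] ++ post).idxOf a = pre.length + mid.length ∧
      (pre ++ [a] ++ mid ++ post).idxOf a = pre.length := by
    simp [List.idxOf_append, hap, ham, Nat.add_comm]
  refine ⟨pre.length, fun y => ?_, fun x y => ?_⟩
  · obtain ⟨i, j, hi, hj, h⟩ := pos y
    rw [hi, hj, ha.1, ha.2]
    lia
  · obtain ⟨i, j, hi, hj, h⟩ := pos y
    obtain ⟨i', j', hi', hj', h'⟩ := pos x
    rw [hi, hj, hi', hj', ha.1]
    grind

/-! ### Comparing and joining stable matchings -/

namespace SMInstance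

lemma boyList_idxOf_inj {Boy Girl : Type*} [DecidableEq Girl] {A : SMInstance Boy Girl} {b : Boy} {g g' : Girl} :
    (A.boyList b).idxOf g = (A.boyList b).idxOf g' ↔ g = g' :=
  List.idxOf_inj (A.mem_boyList b g)

lemma girlList_idxOf_inj {Boy Girl : Type*} [DecidableEq Boy] {A : SMInstance Boy Girl} {g : Girl} {b b' : Boy} :
    (A.girlList g).idxOf b = (A.girlList g).idxOf b' ↔ b = b' :=
  List.idxOf_inj (A.mem_girlList g b)

variable {Boy Girl : Type*} [DecidableEq Boy] [DecidableEq Girl] {A : SMInstance Boy Girl}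
  {K M N M' : Boy ≃ Girl} {ρ σ : Cycle (Boy × Girl)}

/-- Every girl likes her partner in `K` at least as much as her partner in `M`. -/
def GirlsWeaklyPrefer (A : SMInstance Boy Girl) (K M : Boy ≃ Girl) : Prop :=
  ∀ g, (A.girlList g).idxOf (K.symm g) ≤ (A.girlList g).idxOf (M.symm g)

lemma not_girlPrefers_of_stable (hM : M ∈ A.stableMatchings) {b : Boy} {g : Girl}
    (h : A.BoyPrefers b g (M b)) : ¬ A.GirlPrefers g b (M.symm g) :=
  fun h' => hM b g ⟨h, h'⟩

lemma IsFirstWilling.unique {b : Boy} {g g' : Girl} (h : A.IsFirstWilling M b g)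
    (h' : A.IsFirstWilling M b g') : g = g' := by
  rcases h.2 _ h'.1 with h1 | h1
  · exact h1.symm
  rcases h'.2 _ h.1 with h2 | h2
  · exact h2
  · exact absurd h1 (lt_asymm h2)

/-- In a stable matching, a girl willing to accept `b` comes after his partner in his list. -/
lemma boyPrefers_of_willing (hM : M ∈ A.stableMatchings) {b : Boy} {g : Girl}
    (h : A.GirlPrefers g b (M.symm g)) : A.BoyPrefers b (M b) g := by
  by_contra hc
  rcases (not_lt.1 hc).lt_or_eq with h1 | h1
  · exact hM b g ⟨h1, h⟩
  · rw [boyList_idxOf_inj] at h1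
    subst h1
    simp [GirlPrefers] at h

/-- A matching that all girls weakly prefer to a stable matching is weakly worse for all boys. -/
lemma GirlsWeaklyPrefer.boys (h : A.GirlsWeaklyPrefer K M) (hM : M ∈ A.stableMatchings) (b : Boy) :
    (A.boyList b).idxOf (M b) ≤ (A.boyList b).idxOf (K b) := by
  by_contra! hc
  have h1 := h (K b)
  rw [Equiv.symm_apply_apply] at h1
  rcases h1.lt_or_eq with h2 | h2
  · exact hM b (K b) ⟨hc, h2⟩
  · rw [girlList_idxOf_inj] at h2
    rw [h2, Equiv.apply_symm_apply, ← h2] at hc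
    exact lt_irrefl _ hc

/-- The girl-optimal combination of two stable matchings. -/
lemma exists_join [Finite Boy] [Finite Girl] (hM : M ∈ A.stableMatchings)
    (hN : N ∈ A.stableMatchings) :
    ∃ K ∈ A.stableMatchings, A.GirlsWeaklyPrefer K M ∧ A.GirlsWeaklyPrefer K N ∧
      (∀ b, K b = M b ∨ K b = N b) ∧ ∀ g, K.symm g = M.symm g ∨ K.symm g = N.symm g := by
  let f : Girl → Boy := fun g =>
    if (A.girlList g).idxOf (M.symm g) < (A.girlList g).idxOf (N.symm g) then M.symm g else N.symm g
  have hf : ∀ g, (f g = M.symm g ∨ f g = N.symm g) ∧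
      (A.girlList g).idxOf (f g) ≤ (A.girlList g).idxOf (M.symm g) ∧
      (A.girlList g).idxOf (f g) ≤ (A.girlList g).idxOf (N.symm g) := by
    intro g
    by_cases h : (A.girlList g).idxOf (M.symm g) < (A.girlList g).idxOf (N.symm g)
    · simp only [f, if_pos h, true_or, le_refl, true_and]
      exact h.le
    · simp only [f, if_neg h, or_true, le_refl, true_and, and_true]
      exact not_lt.1 h
  -- two girls cannot choose the same boy from different matchings
  have cross : ∀ P Q : Boy ≃ Girl, P ∈ A.stableMatchings → Q ∈ A.stableMatchings → ∀ b,
      A.GirlPrefers (P b) b (Q.symm (P b)) → A.GirlPrefers (Q b) b (P.symm (Q b)) → False := by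
    intro P Q hP hQ b h1 h2
    -- Each of the two girls is willing to take `b` in the other matching, so stability makes him
    -- prefer each of them to the other.
    exact lt_asymm (boyPrefers_of_willing hP h2) (boyPrefers_of_willing hQ h1)
  have cross' : ∀ g g', f g = M.symm g → f g' = N.symm g' → f g = f g' → g = g' := by
    intro g g' h1 h2 h
    by_contra hne
    obtain ⟨b, hb⟩ : ∃ b, b = f g := ⟨_, rfl⟩
    rw [← hb] at h1 h
    have e1 : M b = g := by rw [h1, Equiv.apply_symm_apply]
    have e2 : N b = g' := by rw [h, h2, Equiv.apply_symm_apply]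
    refine cross M N hM hN b ?_ ?_
    · rw [e1]
      have h4 := (hf g).2.2
      rw [← hb] at h4
      refine lt_of_le_of_ne h4 fun h3 => hne ?_
      rw [girlList_idxOf_inj] at h3
      rw [← e2, h3, Equiv.apply_symm_apply]
    · rw [e2]
      have h4 := (hf g').2.1
      rw [← h] at h4
      refine lt_of_le_of_ne h4 fun h3 => hne ?_
      rw [girlList_idxOf_inj] at h3
      rw [← e1, h3, Equiv.apply_symm_apply]
  have hinj : Function.Injective f := by
    intro g g' h
    rcases (hf g).1 with h1 | h1 <;> rcases (hf g').1 with h2 | h2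
    · exact M.symm.injective (by rw [← h1, ← h2, h])
    · exact cross' g g' h1 h2 h
    · exact (cross' g' g h2 h1 h.symm).symm
    · exact N.symm.injective (by rw [← h1, ← h2, h])
  have hbij : Function.Bijective f :=
    (Nat.bijective_iff_injective_and_card f).2 ⟨hinj, (Nat.card_congr M).symm⟩
  let K : Boy ≃ Girl := (Equiv.ofBijective f hbij).symm
  have hK : ∀ g, K.symm g = f g := fun _ => rfl
  have hKM : A.GirlsWeaklyPrefer K M := fun g => (hf g).2.1
  have hKN : A.GirlsWeaklyPrefer K N := fun g => (hf g).2.2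
  have hKb : ∀ b, K b = M b ∨ K b = N b := by
    intro b
    have h := (hf (K b)).1
    rw [← hK, Equiv.symm_apply_apply] at h
    rcases h with h | h
    · left
      rw [Equiv.eq_symm_apply] at h
      exact h.symm
    · right
      rw [Equiv.eq_symm_apply] at h
      exact h.symm
  refine ⟨K, fun b g hbl => ?_, hKM, hKN, hKb, fun g => (hf g).1⟩
  obtain ⟨h1, h2⟩ := hbl
  -- The pair would already block whichever matching gives `b` his `K`-partner, since `g` is no
  -- better off there.
  rcases hKb b with h | h
  · rw [h] at h1
    exact hM b g ⟨h1, lt_of_lt_of_le h2 (hKM g)⟩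
  · rw [h] at h1
    exact hN b g ⟨h1, lt_of_lt_of_le h2 (hKN g)⟩

/-! ### Stable matchings beyond an exposed rotation -/

/-- If a pair of an exposed rotation is broken by a stable matching that the girls weakly prefer,
then so is the next pair, and the latter matching lies beyond the rotation at this step. -/
lemma Exposed.step (hK : K ∈ A.stableMatchings)
    (hKM : A.GirlsWeaklyPrefer K M) (hρ : A.Exposed M ρ) {p q : Boy × Girl}
    (hpq : MatchStep ρ p q) (hp : K p.1 ≠ p.2) :
    (A.boyList p.1).idxOf q.2 ≤ (A.boyList p.1).idxOf (K p.1) ∧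
      (A.girlList q.2).idxOf (K.symm q.2) ≤ (A.girlList q.2).idxOf p.1 ∧ K q.1 ≠ q.2 := by
  obtain ⟨b, g⟩ := p
  obtain ⟨b', g'⟩ := q
  dsimp only at *
  have hMb : M b = g := hρ.2.2.1 _ hpq.left_mem
  have hMb' : M b' = g' := hρ.2.2.1 _ hpq.right_mem
  have hs : A.IsFirstWilling M b g' := hρ.2.2.2 b g g' ⟨b', hpq⟩
  -- The new partner of `b` is willing to leave her `M`-partner for him, so she is `g'` or comes
  -- after `g'` in his list.
  have hw : A.GirlPrefers (K b) b (M.symm (K b)) := by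
    have h := hKM (K b)
    rw [Equiv.symm_apply_apply] at h
    refine lt_of_le_of_ne h fun he => hp ?_
    rw [girlList_idxOf_inj, Equiv.eq_symm_apply] at he
    rw [← hMb, he]
  have h2 : (A.girlList g').idxOf (K.symm g') ≤ (A.girlList g').idxOf b := by
    rcases hs.2 _ hw with h | h
    · rw [← h, Equiv.symm_apply_apply]
    · exact not_lt.1 (not_girlPrefers_of_stable hK h)
  refine ⟨?_, h2, fun he => ?_⟩
  · rcases hs.2 _ hw with h | h
    · rw [h]
    · exact h.le
  · have h3 : K.symm g' = M.symm g' := by rw [← he, Equiv.symm_apply_apply, he, ← hMb',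
      Equiv.symm_apply_apply]
    rw [h3] at h2
    exact absurd hs.1 (not_lt.2 h2)

/-- A stable matching that the girls weakly prefer and that breaks one pair of an exposed rotation
lies beyond the rotation. -/
lemma Exposed.beyond (hK : K ∈ A.stableMatchings)
    (hKM : A.GirlsWeaklyPrefer K M) (hρ : A.Exposed M ρ) {p : Boy × Girl} (hp : p ∈ ρ)
    (hne : K p.1 ≠ p.2) {q r : Boy × Girl} (hqr : MatchStep ρ q r) :
    (A.boyList q.1).idxOf r.2 ≤ (A.boyList q.1).idxOf (K q.1) ∧
      (A.girlList r.2).idxOf (K.symm r.2) ≤ (A.girlList r.2).idxOf q.1 := by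
  have h := forall_mem_of_matchStep (P := fun p => K p.1 ≠ p.2) hp hne
    (fun q r hqr hq => (hρ.step hK hKM hqr hq).2.2) q hqr.left_mem
  exact ⟨(hρ.step hK hKM hqr h).1, (hρ.step hK hKM hqr h).2.1⟩

/-- A rotation stays exposed as long as none of its pairs is broken. -/
lemma Exposed.of_forall_mem (hKM : A.GirlsWeaklyPrefer K M) (hρ : A.Exposed M ρ)
    (h : ∀ p ∈ ρ, K p.1 = p.2) : A.Exposed K ρ := by
  refine ⟨hρ.1, hρ.2.1, h, fun b g g' hmv => ?_⟩
  have hs := hρ.2.2.2 b g g' hmv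
  obtain ⟨b', hstep⟩ := hmv
  have e : K.symm g' = M.symm g' := by
    rw [(Equiv.symm_apply_eq _).2 (h _ hstep.right_mem).symm,
      (Equiv.symm_apply_eq _).2 (hρ.2.2.1 _ hstep.right_mem).symm]
  -- Fewer girls are willing under `K` than under `M`, and `g'` is still among them, so she remains
  -- the first.
  refine ⟨by rw [e]; exact hs.1, fun g'' hg'' => hs.2 g'' (lt_of_lt_of_le hg'' (hKM g''))⟩

/-- Both cycles follow the same successor rule, fixed by `M`: go to the first willing girl and her
`M`-partner. -/
lemma Exposed.eq_of_mem (hρ : A.Exposed M ρ) (hσ : A.Exposed M σ) {p : Boy × Girl} (hpρ : p ∈ ρ)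
    (hpσ : p ∈ σ) : ρ = σ := by
  have key : ∀ τ, A.Exposed M τ → ∀ p q, MatchStep τ p q →
      A.IsFirstWilling M p.1 q.2 ∧ M q.1 = q.2 := fun τ hτ p q h =>
    ⟨hτ.2.2.2 p.1 p.2 q.2 ⟨q.1, h⟩, hτ.2.2.1 _ h.right_mem⟩
  refine eq_of_matchStep_functional
    (R := fun p q => A.IsFirstWilling M p.1 q.2 ∧ M q.1 = q.2) ?_ hρ.2.1 hσ.2.1 (key ρ hρ)
    (key σ hσ) hpρ hpσ
  rintro p q r ⟨h1, h2⟩ ⟨h3, h4⟩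
  have e := h1.unique h3
  exact Prod.ext (M.injective (by rw [h2, h4, e])) e

variable [Finite Boy] [Finite Girl]

/-! ### Intervals skipped by rotations -/

/-- Two rotations that share a pair are equal. -/
lemma eq_of_mem_of_mem (hρ : A.IsRotation ρ) (hσ : A.IsRotation σ) {p : Boy × Girl} (hpρ : p ∈ ρ)
    (hpσ : p ∈ σ) : ρ = σ := by
  obtain ⟨M, hM, hρ⟩ := hρ
  obtain ⟨N, hN, hσ⟩ := hσ
  obtain ⟨K, hK, hKM, hKN, hKb, -⟩ := exists_join hM hN
  have hKp : K p.1 = p.2 := by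
    rcases hKb p.1 with h | h
    · rw [h, hρ.2.2.1 p hpρ]
    · rw [h, hσ.2.2.1 p hpσ]
  -- A pair broken anywhere in the cycle would propagate to `p`, which `K` keeps. Hence both
  -- rotations are exposed in the single matching `K`.
  have stay : ∀ (L : Boy ≃ Girl) (τ : Cycle (Boy × Girl)),
      A.GirlsWeaklyPrefer K L → A.Exposed L τ → p ∈ τ → A.Exposed K τ := by
    intro L τ hKL hτ hpτ
    refine hτ.of_forall_mem hKL fun q hq => ?_
    by_contra hne
    exact forall_mem_of_matchStep (P := fun p => K p.1 ≠ p.2) hq hne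
      (fun q r hqr hq => (hτ.step hK hKL hqr hq).2.2) p hpτ hKp
  exact (stay M ρ hKM hρ hpρ).eq_of_mem (stay N σ hKN hσ hpσ) hpρ hpσ

/-- No partner of `b` in a stable matching lies strictly between the two girls from and to whom a
rotation moves him. -/
lemma Exposed.not_between_boy (hM : M ∈ A.stableMatchings) (hN : N ∈ A.stableMatchings)
    (hρ : A.Exposed M ρ) {b : Boy} {g g' : Girl} (hmv : MovesBoy ρ b g g')
    (h1 : A.BoyPrefers b g (N b)) (h2 : A.BoyPrefers b (N b) g') : False := by
  obtain ⟨b', hstep⟩ := hmv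
  have hMb : M b = g := hρ.2.2.1 _ hstep.left_mem
  obtain ⟨K, hK, hKM, hKN, hKb, -⟩ := exists_join hM hN
  have hKNb : K b = N b := by
    rcases hKb b with h | h
    · have h3 := hKN.boys hN b
      rw [h, hMb] at h3
      exact absurd h1 (not_lt.2 h3)
    · exact h
  have hne : K b ≠ g := by
    rintro rfl
    rw [hKNb] at h1
    exact lt_irrefl _ h1
  have h3 := (hρ.beyond hK hKM hstep.left_mem hne hstep).1
  dsimp only at h3
  rw [hKNb] at h3
  exact absurd h2 (not_lt.2 h3)

/-- No partner of `g` in a stable matching lies strictly between the two boys from and to whom a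
rotation moves her. -/
lemma Exposed.not_between_girl (hM : M ∈ A.stableMatchings) (hN : N ∈ A.stableMatchings)
    (hρ : A.Exposed M ρ) {g : Girl} {b b' : Boy} (hmv : MovesGirl ρ g b b')
    (h1 : A.GirlPrefers g b' (N.symm g)) (h2 : A.GirlPrefers g (N.symm g) b) : False := by
  obtain ⟨g', hstep⟩ := hmv
  have hMb : M.symm g = b := (Equiv.symm_apply_eq _).2 (hρ.2.2.1 _ hstep.right_mem).symm
  obtain ⟨K, hK, hKM, hKN, -, hKg⟩ := exists_join hM hN
  have hKNg : K.symm g = N.symm g := by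
    rcases hKg g with h | h
    · have h3 := hKN g
      rw [h, hMb] at h3
      exact absurd h2 (not_lt.2 h3)
    · exact h
  have hne : K b ≠ g := by
    intro h
    rw [← Equiv.eq_symm_apply, hKNg] at h
    rw [← h] at h2
    exact lt_irrefl _ h2
  have h3 := (hρ.beyond hK hKM hstep.right_mem hne hstep).2
  dsimp only at h3
  rw [hKNg] at h3
  exact absurd h1 (not_lt.2 h3)

/-- Two rotations that move `b` over overlapping intervals of his list are equal. -/
lemma eq_of_movesBoy (hρ : A.IsRotation ρ) (hσ : A.IsRotation σ) {b : Boy} {g₁ g₂ g₃ g₄ : Girl}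
    (h : MovesBoy ρ b g₁ g₂) (h' : MovesBoy σ b g₃ g₄) (h1 : A.BoyPrefers b g₁ g₄)
    (h2 : A.BoyPrefers b g₃ g₂) : ρ = σ := by
  have hρ' := hρ
  have hσ' := hσ
  obtain ⟨M, hM, hρM⟩ := hρ
  obtain ⟨N, hN, hσN⟩ := hσ
  have hm := h
  have hm' := h'
  obtain ⟨b₁, hs⟩ := h
  obtain ⟨b₂, hs'⟩ := h'
  have e1 : M b = g₁ := hρM.2.2.1 _ hs.left_mem
  have e2 : N b = g₃ := hσN.2.2.1 _ hs'.left_mem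
  -- Overlapping intervals either start at the same girl, or one starts strictly inside the other;
  -- that start is a stable partner of `b`.
  rcases lt_trichotomy ((A.boyList b).idxOf g₁) ((A.boyList b).idxOf g₃) with hlt | heq | hlt
  · exact (hρM.not_between_boy hM hN hm (by rwa [e2]) (by rwa [e2])).elim
  · rw [boyList_idxOf_inj] at heq
    subst heq
    exact eq_of_mem_of_mem hρ' hσ' hs.left_mem hs'.left_mem
  · exact (hσN.not_between_boy hN hM hm' (by rwa [e1]) (by rwa [e1])).elim

/-- Two rotations that move `g` over overlapping intervals of her list are equal. -/
lemma eq_of_movesGirl (hρ : A.IsRotation ρ) (hσ : A.IsRotation σ) {g : Girl} {b₁ b₂ b₃ b₄ : Boy}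
    (h : MovesGirl ρ g b₁ b₂) (h' : MovesGirl σ g b₃ b₄) (h1 : A.GirlPrefers g b₄ b₁)
    (h2 : A.GirlPrefers g b₂ b₃) : ρ = σ := by
  have hρ' := hρ
  have hσ' := hσ
  obtain ⟨M, hM, hρM⟩ := hρ
  obtain ⟨N, hN, hσN⟩ := hσ
  have hm := h
  have hm' := h'
  obtain ⟨g₁, hs⟩ := h
  obtain ⟨g₂, hs'⟩ := h'
  have e1 : M.symm g = b₁ := (Equiv.symm_apply_eq _).2 (hρM.2.2.1 _ hs.right_mem).symm
  have e2 : N.symm g = b₃ := (Equiv.symm_apply_eq _).2 (hσN.2.2.1 _ hs'.right_mem).symm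
  rcases lt_trichotomy ((A.girlList g).idxOf b₁) ((A.girlList g).idxOf b₃) with hlt | heq | hlt
  · exact (hσN.not_between_girl hN hM hm' (by rwa [e1]) (by rwa [e1])).elim
  · rw [girlList_idxOf_inj] at heq
    subst heq
    exact eq_of_mem_of_mem hρ' hσ' hs.right_mem hs'.right_mem
  · exact (hρM.not_between_girl hM hN hm (by rwa [e2]) (by rwa [e2])).elim

end SMInstance

/-! ### Eliminating a rotation -/

namespace SMInstance

variable {Boy Girl : Type*} [DecidableEq Boy] [DecidableEq Girl] {A B : SMInstance Boy Girl}
  {M M' : Boy ≃ Girl} {ρ : Cycle (Boy × Girl)} {b : Boy} {g : Girl}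

/-- Eliminating an exposed rotation moves every boy whose partner changes from his old partner to
the new one. -/
lemma Exposed.movesBoy (hρ : A.Exposed M ρ) (hM' : IsElimination M ρ M') {b : Boy}
    (h : M' b ≠ M b) : MovesBoy ρ b (M b) (M' b) := by
  obtain ⟨p, hp, rfl⟩ : ∃ p ∈ ρ, p.1 = b := by
    by_contra! hc
    exact h (hM'.2 b hc)
  obtain ⟨q, hq⟩ := exists_matchStep_right hp
  have h1 : MovesBoy ρ p.1 p.2 q.2 := ⟨q.1, hq⟩
  rwa [hM'.1 _ _ _ h1, hρ.2.2.1 p hp]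

/-- Eliminating an exposed rotation moves every girl whose partner changes from her old partner to
the new one. -/
lemma Exposed.movesGirl (hρ : A.Exposed M ρ) (hM' : IsElimination M ρ M') {g : Girl}
    (h : M'.symm g ≠ M.symm g) : MovesGirl ρ g (M.symm g) (M'.symm g) := by
  obtain ⟨b, rfl⟩ := M'.surjective g
  rw [Equiv.symm_apply_apply] at h ⊢
  have hb : M' b ≠ M b := by
    intro he
    rw [he, Equiv.symm_apply_apply] at h
    exact h rfl
  obtain ⟨b', hs⟩ := hρ.movesBoy hM' hb
  have e : M b' = M' b := hρ.2.2.1 _ hs.right_mem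
  rw [← e, Equiv.symm_apply_apply, e]
  exact ⟨M b, hs⟩

lemma Exposed.girlPrefers (hρ : A.Exposed M ρ) (hM' : IsElimination M ρ M') {g : Girl}
    (h : M'.symm g ≠ M.symm g) : A.GirlPrefers g (M'.symm g) (M.symm g) := by
  obtain ⟨g', hs⟩ := hρ.movesGirl hM' h
  exact (hρ.2.2.2 _ _ _ ⟨_, hs⟩).1

lemma Exposed.girlsWeaklyPrefer (hρ : A.Exposed M ρ) (hM' : IsElimination M ρ M') :
    A.GirlsWeaklyPrefer M' M := by
  intro g
  by_cases h : M'.symm g = M.symm g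
  · rw [h]
  · exact (hρ.girlPrefers hM' h).le

/-- Girls only improve, so a girl in a blocking pair was already willing before the elimination. An
unmoved boy would then block `M` with her, and a moved boy already has the first willing girl. -/
lemma Exposed.elimination_mem_stableMatchings (hM : M ∈ A.stableMatchings) (hρ : A.Exposed M ρ)
    (hM' : IsElimination M ρ M') : M' ∈ A.stableMatchings := by
  rintro b g ⟨h1, h2⟩
  have hw : A.GirlPrefers g b (M.symm g) := lt_of_lt_of_le h2 (hρ.girlsWeaklyPrefer hM' g)
  by_cases hb : M' b = M b
  · rw [hb] at h1
    exact hM b g ⟨h1, hw⟩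
  · rcases (hρ.2.2.2 _ _ _ (hρ.movesBoy hM' hb)).2 g hw with h | h
    · rw [h] at h1
      exact lt_irrefl _ h1
    · exact lt_asymm h h1

/-! ### Lost matchings -/

/-- The matchings lost by an upward shift of `b` in the list of `g`. -/
lemma IsGirlShift.exists_mem_lostMatchings_iff {b : Boy} {g : Girl} (h : A.IsGirlShift B g b) :
    ∃ m, ∀ M : Boy ≃ Girl, M ∈ A.lostMatchings B ↔ M ∈ A.stableMatchings ∧
      m ≤ (A.girlList g).idxOf (M.symm g) ∧ A.GirlPrefers g (M.symm g) b ∧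
        A.BoyPrefers b g (M b) := by
  obtain ⟨hboy, hgirl, pre, mid, post, hl, hl'⟩ := h
  obtain ⟨m, hm, hm'⟩ := List.exists_shift_idxOf (A.girlList_nodup g) hl hl'
  refine ⟨m, fun M => ⟨fun ⟨hA, hB⟩ => ⟨hA, ?_⟩, fun ⟨hA, h1, h2, h3⟩ => ⟨hA, fun hB => ?_⟩⟩⟩
  · simp only [stableMatchings, Set.mem_ofPred_eq, not_forall, not_not] at hB
    obtain ⟨x, y, h1, h2⟩ := hB
    unfold BoyPrefers at h1
    rw [hboy] at h1
    have hn := not_girlPrefers_of_stable hA h1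
    -- Only comparisons of `b` with the block changed, so a pair that blocks in `B` but not in `A`
    -- must be `b` with `g`.
    by_cases hy : y = g
    · subst hy
      rcases hm' _ _ h2 with h | ⟨rfl, h4, h5⟩
      · exact absurd h hn
      · exact ⟨h4, h5, h1⟩
    · unfold GirlPrefers at h2
      rw [hgirl y hy] at h2
      exact absurd h2 hn
  · refine hB b g ⟨?_, hm _ h1 h2⟩
    unfold BoyPrefers
    rwa [hboy]

/-- The matchings lost by an upward shift of `g` in the list of `b`. -/
lemma IsBoyShift.exists_mem_lostMatchings_iff {b : Boy} {g : Girl} (h : A.IsBoyShift B b g) :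
    ∃ m, ∀ M : Boy ≃ Girl, M ∈ A.lostMatchings B ↔ M ∈ A.stableMatchings ∧
      m ≤ (A.boyList b).idxOf (M b) ∧ A.BoyPrefers b (M b) g ∧
        A.GirlPrefers g b (M.symm g) := by
  obtain ⟨hgirl, hboy, pre, mid, post, hl, hl'⟩ := h
  obtain ⟨m, hm, hm'⟩ := List.exists_shift_idxOf (A.boyList_nodup b) hl hl'
  refine ⟨m, fun M => ⟨fun ⟨hA, hB⟩ => ⟨hA, ?_⟩, fun ⟨hA, h1, h2, h3⟩ => ⟨hA, fun hB => ?_⟩⟩⟩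
  · simp only [stableMatchings, Set.mem_ofPred_eq, not_forall, not_not] at hB
    obtain ⟨x, y, h1, h2⟩ := hB
    unfold GirlPrefers at h2
    rw [hgirl] at h2
    by_cases hx : x = b
    · subst hx
      rcases hm' _ _ h1 with h | ⟨rfl, h4, h5⟩
      · exact absurd h2 (not_girlPrefers_of_stable hA h)
      · exact ⟨h4, h5, h2⟩
    · unfold BoyPrefers at h1
      rw [hboy x hx] at h1
      exact absurd h2 (not_girlPrefers_of_stable hA h1)
  · refine hB b g ⟨hm _ h1 h2, ?_⟩
    unfold GirlPrefers
    rwa [hgirl]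

lemma IsRotation.boyPrefers (hρ : A.IsRotation ρ) {b : Boy} {g g' : Girl}
    (h : MovesBoy ρ b g g') : A.BoyPrefers b g g' := by
  obtain ⟨M, hM, hρ⟩ := hρ
  have h1 := boyPrefers_of_willing hM (hρ.2.2.2 _ _ _ h).1
  obtain ⟨b', hs⟩ := h
  rwa [show M b = g from hρ.2.2.1 _ hs.left_mem] at h1

lemma IsRotation.girlPrefers (hρ : A.IsRotation ρ) {g : Girl} {b b' : Boy}
    (h : MovesGirl ρ g b b') : A.GirlPrefers g b' b := by
  obtain ⟨M, hM, hρ⟩ := hρ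
  obtain ⟨g', hs⟩ := h
  have h1 := (hρ.2.2.2 _ _ _ ⟨_, hs⟩).1
  rwa [(Equiv.symm_apply_eq _).2 (hρ.2.2.1 _ hs.right_mem).symm] at h1

lemma IsRotation.of_mem_rotationsInto {S : Set (Boy ≃ Girl)} (h : ρ ∈ A.rotationsInto S) :
    A.IsRotation ρ :=
  let ⟨M, _, hM, hρ, _⟩ := h
  ⟨M, hM, hρ⟩

lemma IsRotation.of_mem_rotationsOutOf {S : Set (Boy ≃ Girl)} (h : ρ ∈ A.rotationsOutOf S) :
    A.IsRotation ρ :=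
  let ⟨M, _, hM, hρ, _⟩ := h
  ⟨M, hM, hρ⟩

/-! ### Crossing the boundary of the lost set -/

/-- A rotation going into the matchings lost by a shift of `b` in the list of `g` moves `b` below
`g`: a stable matching in which `b` is already below `g` gives `g` a partner above `b`, and `g`
only improves. -/
lemma IsGirlShift.movesBoyBelow (hAB : A.IsGirlShift B g b)
    (hρ : ρ ∈ A.rotationsInto (A.lostMatchings B)) : A.MovesBoyBelow b g ρ := by
  obtain ⟨m, hlost⟩ := hAB.exists_mem_lostMatchings_iff
  obtain ⟨M, M', hM, hex, hel, hnot, hin⟩ := hρ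
  obtain ⟨-, h1, -, h3⟩ := (hlost M').1 hin
  have hge : ¬ A.BoyPrefers b g (M b) := fun hlt =>
    hnot ((hlost M).2 ⟨hM, h1.trans (hex.girlsWeaklyPrefer hel g), by
      refine lt_of_le_of_ne (not_lt.1 (not_girlPrefers_of_stable hM hlt)) fun he => ?_
      rw [girlList_idxOf_inj, Equiv.symm_apply_eq] at he
      rw [← he] at hlt
      exact lt_irrefl _ hlt, hlt⟩)
  have hmv := hex.movesBoy hel (b := b) fun he => hge (by rwa [← he])
  refine ⟨M b, M' b, hmv, ?_⟩
  rcases (not_lt.1 hge).lt_or_eq with h | h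
  · exact Or.inr ⟨h, h3⟩
  · exact Or.inl (boyList_idxOf_inj.1 h).symm

/-- A rotation going out of the matchings lost by a shift of `b` in the list of `g` moves `g` out
of the block that `b` passes. -/
lemma IsGirlShift.exists_movesGirl (hAB : A.IsGirlShift B g b) :
    ∃ m, (∀ M ∈ A.lostMatchings B, m ≤ (A.girlList g).idxOf (M.symm g)) ∧
      ∀ ρ ∈ A.rotationsOutOf (A.lostMatchings B), ∃ M ∈ A.lostMatchings B, A.Exposed M ρ ∧
        ∃ b', MovesGirl ρ g (M.symm g) b' ∧ (A.girlList g).idxOf b' < m := by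
  obtain ⟨m, hlost⟩ := hAB.exists_mem_lostMatchings_iff
  refine ⟨m, fun M hM => ((hlost M).1 hM).2.1, ?_⟩
  rintro ρ ⟨M, M', hM, hex, hel, hin, hnot⟩
  obtain ⟨-, h1, h2, h3⟩ := (hlost M).1 hin
  have hM' := hex.elimination_mem_stableMatchings hM hel
  have hw := hex.girlsWeaklyPrefer hel
  -- The other two inequalities survive elimination by monotonicity, so only the upper end of the
  -- block can be crossed.
  have hlt : (A.girlList g).idxOf (M'.symm g) < m := by
    by_contra! hc
    exact hnot ((hlost M').2 ⟨hM', hc, lt_of_le_of_lt (hw g) h2, lt_of_lt_of_le h3 (hw.boys hM b)⟩)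
  refine ⟨M, hin, hex, M'.symm g, hex.movesGirl hel fun he => ?_, hlt⟩
  rw [he] at hlt
  exact absurd hlt (not_lt.2 h1)

/-- A rotation going into the matchings lost by a shift of `g` in the list of `b` moves `b` into
the block that `g` passes. -/
lemma IsBoyShift.exists_movesBoy (hAB : A.IsBoyShift B b g) :
    ∃ m, (∀ M ∈ A.lostMatchings B, m ≤ (A.boyList b).idxOf (M b)) ∧
      ∀ ρ ∈ A.rotationsInto (A.lostMatchings B), ∃ M' ∈ A.lostMatchings B,
        ∃ g', MovesBoy ρ b g' (M' b) ∧ (A.boyList b).idxOf g' < m := by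
  obtain ⟨m, hlost⟩ := hAB.exists_mem_lostMatchings_iff
  refine ⟨m, fun M hM => ((hlost M).1 hM).2.1, ?_⟩
  rintro ρ ⟨M, M', hM, hex, hel, hnot, hin⟩
  obtain ⟨-, h1, h2, h3⟩ := (hlost M').1 hin
  have hw := hex.girlsWeaklyPrefer hel
  -- The other two inequalities pass back from `M'` to `M`: there `b` is no worse off and `g` no
  -- better off.
  have hlt : (A.boyList b).idxOf (M b) < m := by
    by_contra! hc
    exact hnot ((hlost M).2 ⟨hM, hc, lt_of_le_of_lt (hw.boys hM b) h2, lt_of_lt_of_le h3 (hw g)⟩)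
  refine ⟨M', hin, M b, hex.movesBoy hel fun he => ?_, hlt⟩
  rw [he] at h1
  exact absurd hlt (not_lt.2 h1)

/-- A rotation going out of the matchings lost by a shift of `g` in the list of `b` either marries
`b` and `g` or moves `g` above `b`. -/
lemma IsBoyShift.movesBoy_or_movesGirl (hAB : A.IsBoyShift B b g)
    (hρ : ρ ∈ A.rotationsOutOf (A.lostMatchings B)) :
    ∃ M ∈ A.lostMatchings B, A.Exposed M ρ ∧
      ((MovesBoy ρ b (M b) g ∧ ∃ M' ∈ A.stableMatchings, M' b = g) ∨
        ∃ b', MovesGirl ρ g (M.symm g) b' ∧ A.GirlPrefers g b' b ∧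
          A.GirlPrefers g b (M.symm g)) := by
  obtain ⟨m, hlost⟩ := hAB.exists_mem_lostMatchings_iff
  obtain ⟨M, M', hM, hex, hel, hin, hnot⟩ := hρ
  obtain ⟨-, h1, h2, h3⟩ := (hlost M).1 hin
  have hM' := hex.elimination_mem_stableMatchings hM hel
  have hw := hex.girlsWeaklyPrefer hel
  refine ⟨M, hin, hex, ?_⟩
  by_cases hg : M' b = g
  · left
    have hmv := hex.movesBoy hel (b := b) fun he => by
      rw [hg] at he
      rw [← he] at h2
      exact lt_irrefl _ h2
    rw [hg] at hmv
    exact ⟨hmv, M', hM', hg⟩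
  right
  have hgb : A.GirlPrefers g (M'.symm g) b := by
    refine lt_of_le_of_ne ?_ fun he => hg ?_
    -- If `g` still preferred `b`, then `b` below `g` would give a blocking pair of `M'`, and `b`
    -- above `g` would leave `M'` lost.
    · by_contra! hc
      rcases lt_trichotomy ((A.boyList b).idxOf g) ((A.boyList b).idxOf (M' b)) with h | h | h
      · exact hM' b g ⟨h, hc⟩
      · exact hg (boyList_idxOf_inj.1 h).symm
      · exact hnot ((hlost M').2 ⟨hM', h1.trans (hw.boys hM b), h, hc⟩)
    · rw [girlList_idxOf_inj, Equiv.symm_apply_eq] at he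
      exact he.symm
  refine ⟨M'.symm g, hex.movesGirl hel fun he => ?_, hgb, h3⟩
  rw [he] at hgb
  exact lt_asymm hgb h3

variable [Finite Boy] [Finite Girl] {σ : Cycle (Boy × Girl)}

/-! ### Uniqueness and identification of the rotations -/

/-- At most one rotation moves `b` below `g`. -/
lemma eq_of_movesBoyBelow (hρ : A.IsRotation ρ) (hσ : A.IsRotation σ)
    (h : A.MovesBoyBelow b g ρ) (h' : A.MovesBoyBelow b g σ) : ρ = σ := by
  -- Both alternatives put `g` in the interval that includes `g₁` and excludes `g₂`; two such
  -- intervals overlap.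
  have key : ∀ τ, A.IsRotation τ → A.MovesBoyBelow b g τ → ∃ g₁ g₂, MovesBoy τ b g₁ g₂ ∧
      (A.boyList b).idxOf g₁ ≤ (A.boyList b).idxOf g ∧ A.BoyPrefers b g g₂ := by
    rintro τ hτ ⟨g₁, g₂, hm, rfl | ⟨h1, h2⟩⟩
    · exact ⟨g, g₂, hm, le_rfl, hτ.boyPrefers hm⟩
    · exact ⟨g₁, g₂, hm, h1.le, h2⟩
  obtain ⟨g₁, g₂, h1, h2, h3⟩ := key ρ hρ h
  obtain ⟨g₃, g₄, h4, h5, h6⟩ := key σ hσ h'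
  exact eq_of_movesBoy hρ hσ h1 h4 (lt_of_le_of_lt h2 h6) (lt_of_le_of_lt h5 h3)

/-- At most one rotation moves `g` above `b`. -/
lemma eq_of_movesGirlAbove (hρ : A.IsRotation ρ) (hσ : A.IsRotation σ)
    (h : A.MovesGirlAbove g b ρ) (h' : A.MovesGirlAbove g b σ) : ρ = σ := by
  have key : ∀ τ, A.IsRotation τ → A.MovesGirlAbove g b τ → ∃ b₁ b₂, MovesGirl τ g b₁ b₂ ∧
      (A.girlList g).idxOf b ≤ (A.girlList g).idxOf b₁ ∧ A.GirlPrefers g b₂ b := by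
    rintro τ hτ ⟨b₁, b₂, hm, rfl | ⟨h1, h2⟩⟩
    · exact ⟨b, b₂, hm, le_rfl, hτ.girlPrefers hm⟩
    · exact ⟨b₁, b₂, hm, h2.le, h1⟩
  obtain ⟨b₁, b₂, h1, h2, h3⟩ := key ρ hρ h
  obtain ⟨b₃, b₄, h4, h5, h6⟩ := key σ hσ h'
  exact eq_of_movesGirl hρ hσ h1 h4 (lt_of_lt_of_le h6 h2) (lt_of_lt_of_le h3 h5)

/-- The effect of an upward shift of `b` in the list of `g`. -/
lemma IsGirlShift.rotations (hAB : A.IsGirlShift B g b) :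
    (A.rotationsInto (A.lostMatchings B)).Subsingleton ∧
    (A.rotationsOutOf (A.lostMatchings B)).Subsingleton ∧
    (∀ ρ ∈ A.rotationsInto (A.lostMatchings B), A.IsTheRotation (A.MovesBoyBelow b g) ρ) ∧
    (∀ ρ ∈ A.rotationsOutOf (A.lostMatchings B),
      ∃ bBest, A.IsBestBoy (A.lostMatchings B) g bBest ∧
        A.IsTheRotation (fun σ => ∃ b', MovesGirl σ g bBest b') ρ) := by
  obtain ⟨m, hm, hout⟩ := hAB.exists_movesGirl
  refine ⟨fun ρ hρ σ hσ => ?_, fun ρ hρ σ hσ => ?_, fun ρ hρ => ?_, fun ρ hρ => ?_⟩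
  · exact eq_of_movesBoyBelow (.of_mem_rotationsInto hρ) (.of_mem_rotationsInto hσ)
      (hAB.movesBoyBelow hρ) (hAB.movesBoyBelow hσ)
  · obtain ⟨M, hM, -, b₁, h1, h2⟩ := hout ρ hρ
    obtain ⟨N, hN, -, b₂, h3, h4⟩ := hout σ hσ
    -- Both intervals straddle the threshold `m`, hence overlap.
    exact eq_of_movesGirl (.of_mem_rotationsOutOf hρ) (.of_mem_rotationsOutOf hσ) h1 h3
      (lt_of_lt_of_le h4 (hm M hM)) (lt_of_lt_of_le h2 (hm N hN))
  · have hρ' := IsRotation.of_mem_rotationsInto hρ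
    exact ⟨hρ', hAB.movesBoyBelow hρ, fun σ hσ h =>
      eq_of_movesBoyBelow hσ hρ' h (hAB.movesBoyBelow hρ)⟩
  · have hρ' := IsRotation.of_mem_rotationsOutOf hρ
    obtain ⟨M, hM, hex, b₁, h1, h2⟩ := hout ρ hρ
    refine ⟨M.symm g, ⟨⟨M, hM, M.apply_symm_apply g⟩, fun N hN => ?_⟩, hρ', ⟨b₁, h1⟩, ?_⟩
    · by_contra! hc
      -- A better lost partner would lie in the block, hence strictly between `b₁` and the current
      -- partner.
      refine hex.not_between_girl hM.1 hN.1 h1 (lt_of_lt_of_le h2 (hm N hN)) ?_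
      refine lt_of_le_of_ne (not_lt.1 hc.2) fun he => hc.1 ?_
      rw [girlList_idxOf_inj] at he
      rw [← he, Equiv.apply_symm_apply]
    · rintro σ hσ ⟨b₂, h3⟩
      exact eq_of_movesGirl hσ hρ' h3 h1 (hρ'.girlPrefers h1) (hσ.girlPrefers h3)

/-- The effect of an upward shift of `g` in the list of `b`. -/
lemma IsBoyShift.rotations (hAB : A.IsBoyShift B b g) :
    (A.rotationsInto (A.lostMatchings B)).Subsingleton ∧
    (A.rotationsOutOf (A.lostMatchings B)).Subsingleton ∧
    (∀ ρ ∈ A.rotationsInto (A.lostMatchings B),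
      ∃ gBest, A.IsBestGirl (A.lostMatchings B) b gBest ∧
        A.IsTheRotation (fun σ => ∃ g', MovesBoy σ b g' gBest) ρ) ∧
    (∀ ρ ∈ A.rotationsOutOf (A.lostMatchings B),
      (∃ gWorst, A.IsWorstGirl (A.lostMatchings B) b gWorst ∧
        A.IsTheRotation (fun σ => ∃ g', MovesBoy σ b gWorst g') ρ) ∨
      A.IsTheRotation (A.MovesGirlAbove g b) ρ) := by
  obtain ⟨m, hm, hin⟩ := hAB.exists_movesBoy
  obtain ⟨_, hlost⟩ := hAB.exists_mem_lostMatchings_iff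
  -- if `b` and `g` form a stable pair, no rotation moves `g` past `b`
  have excl : ∀ ρ M M' b', M ∈ A.stableMatchings → A.Exposed M ρ →
      MovesGirl ρ g (M.symm g) b' → A.GirlPrefers g b' b → A.GirlPrefers g b (M.symm g) →
      M' ∈ A.stableMatchings → M' b = g → False := by
    intro ρ M M' b' hM hex h1 h2 h3 hM' he
    have e : M'.symm g = b := (Equiv.symm_apply_eq _).2 he.symm
    exact hex.not_between_girl hM hM' h1 (by rwa [e]) (by rwa [e])
  refine ⟨fun ρ hρ σ hσ => ?_, fun ρ hρ σ hσ => ?_, fun ρ hρ => ?_, fun ρ hρ => ?_⟩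
  · obtain ⟨M, hM, g₁, h1, h2⟩ := hin ρ hρ
    obtain ⟨N, hN, g₂, h3, h4⟩ := hin σ hσ
    exact eq_of_movesBoy (.of_mem_rotationsInto hρ) (.of_mem_rotationsInto hσ) h1 h3
      (lt_of_lt_of_le h2 (hm N hN)) (lt_of_lt_of_le h4 (hm M hM))
  · have hρ' := IsRotation.of_mem_rotationsOutOf hρ
    have hσ' := IsRotation.of_mem_rotationsOutOf hσ
    -- Two exits of the same kind overlap; exits of different kinds are ruled out by `excl`.
    obtain ⟨M, hM, hMρ, ⟨h1, L, hL, hLg⟩ | ⟨b₁, h1, h2, h3⟩⟩ := hAB.movesBoy_or_movesGirl hρ <;>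
    obtain ⟨N, hN, hNσ, ⟨h4, L', hL', hLg'⟩ | ⟨b₂, h4, h5, h6⟩⟩ := hAB.movesBoy_or_movesGirl hσ
    · exact eq_of_movesBoy hρ' hσ' h1 h4 (hρ'.boyPrefers h1) (hσ'.boyPrefers h4)
    · exact (excl σ N L b₂ hN.1 hNσ h4 h5 h6 hL hLg).elim
    · exact (excl ρ M L' b₁ hM.1 hMρ h1 h2 h3 hL' hLg').elim
    · exact eq_of_movesGirl hρ' hσ' h1 h4 (lt_trans h5 h3) (lt_trans h2 h6)
  · have hρ' := IsRotation.of_mem_rotationsInto hρ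
    obtain ⟨M, hM, g₁, h1, h2⟩ := hin ρ hρ
    refine ⟨M b, ⟨⟨M, hM, rfl⟩, fun N hN => ?_⟩, hρ', ⟨g₁, h1⟩, ?_⟩
    · by_contra! hc
      obtain ⟨L, hL, hex⟩ := hρ'
      refine hex.not_between_boy hL hN.1 h1 (lt_of_lt_of_le h2 (hm N hN)) ?_
      refine lt_of_le_of_ne (not_lt.1 hc.2) fun he => hc.1 ?_
      rwa [boyList_idxOf_inj] at he
    · rintro σ hσ ⟨g₂, h3⟩
      exact eq_of_movesBoy hσ hρ' h3 h1 (hσ.boyPrefers h3) (hρ'.boyPrefers h1)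
  · have hρ' := IsRotation.of_mem_rotationsOutOf hρ
    obtain ⟨M, hM, hex, ⟨h, -⟩ | ⟨b₁, h1, h2, h3⟩⟩ := hAB.movesBoy_or_movesGirl hρ
    · left
      refine ⟨M b, ⟨⟨M, hM, rfl⟩, fun N hN => ?_⟩, hρ', ⟨g, h⟩, ?_⟩
      · by_contra! hc
        -- A worse lost partner would still precede `g`, hence lie strictly inside the interval
        -- skipped by `ρ`.
        refine hex.not_between_boy hM.1 hN.1 h ?_ ((hlost N).1 hN).2.2.1
        refine lt_of_le_of_ne (not_lt.1 hc.2) fun he => hc.1 ?_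
        exact (boyList_idxOf_inj.1 he).symm
      · rintro σ hσ ⟨g₂, h3⟩
        exact eq_of_movesBoy hσ hρ' h3 h (hρ'.boyPrefers h) (hσ.boyPrefers h3)
    · right
      have h : A.MovesGirlAbove g b ρ := ⟨_, _, h1, Or.inr ⟨h2, h3⟩⟩
      exact ⟨hρ', h, fun σ hσ hσ' => eq_of_movesGirlAbove hσ hρ' hσ' h⟩

end SMInstance

theorem theorem3p6 {Boy Girl : Type*} [Finite Boy] [Finite Girl] [DecidableEq Boy]
    [DecidableEq Girl] (A B : SMInstance Boy Girl) (b : Boy) (g : Girl) :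
    (A.IsGirlShift B g b →
      (A.rotationsInto (A.lostMatchings B)).Subsingleton ∧
      (A.rotationsOutOf (A.lostMatchings B)).Subsingleton ∧
      (∀ ρ ∈ A.rotationsInto (A.lostMatchings B),
        (∃ bWorst, A.IsWorstBoy (A.lostMatchings B) g bWorst ∧
          A.IsTheRotation (fun σ => ∃ b', MovesGirl σ g b' bWorst) ρ) ∨
        A.IsTheRotation (A.MovesBoyBelow b g) ρ) ∧
      (∀ ρ ∈ A.rotationsOutOf (A.lostMatchings B),
        ∃ bBest, A.IsBestBoy (A.lostMatchings B) g bBest ∧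
          A.IsTheRotation (fun σ => ∃ b', MovesGirl σ g bBest b') ρ)) ∧
    (A.IsBoyShift B b g →
      (A.rotationsInto (A.lostMatchings B)).Subsingleton ∧
      (A.rotationsOutOf (A.lostMatchings B)).Subsingleton ∧
      (∀ ρ ∈ A.rotationsInto (A.lostMatchings B),
        ∃ gBest, A.IsBestGirl (A.lostMatchings B) b gBest ∧
          A.IsTheRotation (fun σ => ∃ g', MovesBoy σ b g' gBest) ρ) ∧
      (∀ ρ ∈ A.rotationsOutOf (A.lostMatchings B),
        (∃ gWorst, A.IsWorstGirl (A.lostMatchings B) b gWorst ∧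
          A.IsTheRotation (fun σ => ∃ g', MovesBoy σ b gWorst g') ρ) ∨
        A.IsTheRotation (A.MovesGirlAbove g b) ρ)) := by
  refine ⟨fun h => ?_, fun h => h.rotations⟩
  obtain ⟨h1, h2, h3, h4⟩ := h.rotations
  -- An entering rotation always moves `b` below `g`, so the second alternative suffices.
  exact ⟨h1, h2, fun ρ hρ => Or.inr (h3 ρ hρ), h4⟩
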